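/- Let $\varepsilon,\zeta\in(0,1)$, let $\sigma_{\min}>1$, and let $C\in\mathbb R^{d\times d}$ be a matrix all of whose singular values lie in $[\sigma_{\min},\sigma_{\max}]$. Let $m,n\ge 0$ be integers with $$m\ \ge\ \mathcal M\Big(\varepsilon\log\sigma_{\min},\tfrac{\sigma_{\max}}{\sigma_{\min}},\zeta\Big),\qquad n\ \ge\ \mathcal N\Big(\varepsilon\log\sigma_{\min},\tfrac{\sigma_{\max}}{\sigma_{\min}}\Big),$$ where $$\mathcal M(\varepsilon,\kappa,\zeta)=\frac{14}{\varepsilon^2}\big(\log(1+\kappa^2)\big)^2\log\frac2\zeta,\qquad \mathcal N(\varepsilon,\kappa)=\frac{\log\Big(\frac{20}{\varepsilon}\big(\sqrt{2\kappa^2+1}-1\big)\frac{\log(1+\kappa^2)\,\log(2\kappa^2)}{\log(1+\kappa^{-2})}\Big)}{\log\Big(\frac{\sqrt{2\kappa^2+1}+1}{\sqrt{2\kappa^2+1}-1}\Big)}.$$ Then the output $\Gamma$ of the following randomized algorithm satisfies $$\Pr\big[\,\big|\log|\det C|-\Gamma\big|\le\varepsilon\,\log|\det C|\,\big]\ \ge\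 1-\zeta .$$ Algorithm. Put $B=\frac{1}{\sigma_{\min}^2+\sigma_{\max}^2}C^{\top}C$, $\delta=\frac{\sigma_{\min}^2}{\sigma_{\min}^2+\sigma_{\max}^2}$, $A=I-B$ and $X=\frac{1}{1-2\delta}(2A-I)$ (when $\delta=1/2$, so that $2A-I=0$, put $X=0$). Let $c_0,\dots,c_n$ be the coefficients of the degree-$n$ Chebyshev approximation of $f(x)=\log\big(1-\frac{(1-2\delta)x+1}{2}\big)$ on $[-1,1]$, that is, $c_0=\frac1{n+1}\sum_{k=0}^n f(x_k)$ and $c_i=\frac2{n+1}\sum_{k=0}^n f(x_k)T_i(x_k)$ for $1\le i\le n$, with $x_k=\cos\frac{\pi(k+1/2)}{n+1}$ and $T_i$ the $i$-th Chebyshev polynomial of the first kind. Draw independent random vectors $v_1,\dots,v_m\in\{-1,1\}^d$ with independent Rademacher entries ($\pm1$ with probability $\frac12$ each). For each $i$ compute $w_0=v_i$, $w_1=Xv_i$, $w_{j+1}=2Xw_j-w_{j-1}$, and put $u_i=\sum_{j=0}^n c_jw_j$ if $n>1$, and $u_i=c_0v_i$ if $n\le1$. Output $$\Gamma=\frac12\Big(\frac1m\sum_{i=1}^m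 v_i^{\top}u_i+d\log(\sigma_{\min}^2+\sigma_{\max}^2)\Big).$$ -/

import Mathlib

open MeasureTheory ProbabilityTheory
open scoped Matrix

/-- The `n + 1` Chebyshev nodes `x_k = cos (π (k + 1/2) / (n + 1))`, `0 ≤ k ≤ n`. -/
noncomputable def chebNode (n k : ℕ) : ℝ :=
  Real.cos (Real.pi * ((k : ℝ) + 1 / 2) / ((n : ℝ) + 1))

/-- The `i`-th coefficient of the degree `n` Chebyshev approximation `∑ i ≤ n, c_i T_i` of a
function `f` on `[-1, 1]`. -/
noncomputable def chebCoeff (f : ℝ → ℝ) (n i : ℕ) : ℝ :=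
  (if i = 0 then 1 else 2) / ((n : ℝ) + 1) *
    ∑ k ∈ Finset.range (n + 1),
      f (chebNode n k) * (Polynomial.Chebyshev.T ℝ (i : ℤ)).eval (chebNode n k)

/-- The vectors `w_0 = v`, `w_1 = X v`, `w_{j+2} = 2 X w_{j+1} - w_j`, that is `w_j = T_j(X) v`,
computed through matrix-vector products only. -/
noncomputable def chebVec {d : ℕ} (X : Matrix (Fin d) (Fin d) ℝ) (v : Fin d → ℝ) :
    ℕ → (Fin d → ℝ)
  | 0 => v
  | 1 => X *ᵥ v
  | (j + 2) => (2 : ℝ) • (X *ᵥ chebVec X v (j + 1)) - chebVec X v j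

/-- The output of the algorithm for positive definite matrices `B` with spectrum in `[δ, 1 - δ]`,
with polynomial degree `n`, when the `m` random vectors drawn are `v 0, …, v (m - 1)`.

With `A = I - B` and `f (x) = log (1 - g x)`, where `g x = ((1 - 2 δ) x + 1) / 2` maps `[-1, 1]`
onto `[δ, 1 - δ]`, the recursion is run on `g⁻¹(A) = (2 A - I) / (1 - 2 δ)`. -/
noncomputable def logDetPD {d : ℕ} (B : Matrix (Fin d) (Fin d) ℝ) (m n : ℕ) (δ : ℝ)
    (v : Fin m → Fin d → ℝ) : ℝ :=
  let A : Matrix (Fin d) (Fin d) ℝ := 1 - B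
  let X : Matrix (Fin d) (Fin d) ℝ := (1 - 2 * δ)⁻¹ • ((2 : ℝ) • A - 1)
  let c : ℕ → ℝ := chebCoeff (fun x => Real.log (1 - ((1 - 2 * δ) * x + 1) / 2)) n
  let u : Fin m → Fin d → ℝ := fun i =>
    if 1 < n then ∑ j ∈ Finset.range (n + 1), c j • chebVec X (v i) j else c 0 • v i
  ∑ i, (v i ⬝ᵥ u i) / (m : ℝ)

/-- The output of the algorithm for general non-singular matrices `C` with singular values in
`[σmin, σmax]`, with polynomial degree `n`, when the `m` random vectors drawn are
`v 0, …, v (m - 1)`. -/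
noncomputable def logDetGeneral {d : ℕ} (C : Matrix (Fin d) (Fin d) ℝ) (σmin σmax : ℝ) (m n : ℕ)
    (v : Fin m → Fin d → ℝ) : ℝ :=
  let B : Matrix (Fin d) (Fin d) ℝ := (1 / (σmin ^ 2 + σmax ^ 2)) • (Cᵀ * C)
  let δ : ℝ := σmin ^ 2 / (σmin ^ 2 + σmax ^ 2)
  (logDetPD B m n δ v + (d : ℝ) * Real.log (σmin ^ 2 + σmax ^ 2)) / 2

/-- The threshold `𝓜(ε, κ, ζ)` for the number of samples. -/
noncomputable def sampleThreshold (ε κ ζ : ℝ) : ℝ :=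
  14 / ε ^ 2 * (Real.log (1 + κ ^ 2)) ^ 2 * Real.log (2 / ζ)

/-- The threshold `𝓝(ε, κ)` for the polynomial degree. -/
noncomputable def degreeThreshold (ε κ : ℝ) : ℝ :=
  Real.log (20 / ε * (√(2 * κ ^ 2 + 1) - 1) *
      (Real.log (1 + κ ^ 2) * Real.log (2 * κ ^ 2) / Real.log (1 + (κ ^ 2)⁻¹))) /
    Real.log ((√(2 * κ ^ 2 + 1) + 1) / (√(2 * κ ^ 2 + 1) - 1))

/-- The Rademacher distribution: `+1` and `-1` with probability `1/2` each. -/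
noncomputable def rademacher : Measure ℝ :=
  (2⁻¹ : ENNReal) • Measure.dirac 1 + (2⁻¹ : ENNReal) • Measure.dirac (-1)

/-! In an orthonormal basis `u j` of right singular vectors of `C`, a sample `vᵀ p(X) v` equals `∑
j, p (x j) * (u j ⬝ᵥ v) ^ 2`, where `x j ∈ [-1, 1]` are the eigenvalues of `X`. For Rademacher `v`
the weights have mean 1 and total exactly `d`. So the sample has mean `∑ j, p (x j)`, and it lies in
`[d a, d b]` when `p` takes values in `[a, b]` at the `x j`. Hoeffding's inequality then controls
the average over `m` samples.

The polynomial `p` interpolates `f` at the Chebyshev nodes. With `r = (κ - 1) / (κ + 1)`, `f` is the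
logarithm of a constant multiple of `1 - 2 r x + r²`, so its Chebyshev series is explicit and decays
like `r ^ j`. Aliasing bounds each interpolated `T_j` by 1, and the error is a geometric tail.

Put `η = ε log σmin`. Since `log |det C| ≥ d log σmin` and the output is half the trace plus a
constant, a trace error of `2 η d` suffices: `η d / 5` goes to interpolation and `9 η d / 5` to
sampling. The truncated output for `n ≤ 1` is harmless: the degree bound then forces `log (1 + κ²) ≤
η`, and the whole range of the estimator is within tolerance. -/

/-! ### Chebyshev interpolation and aliasing -/

open Polynomial.Chebyshev in
theorem sum_T_eval_chebNode_eq_zero {n : ℕ} {j : ℤ} (hj : ¬ (2 * ((n : ℤ) + 1)) ∣ j) :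
    ∑ k ∈ Finset.range (n + 1), (T ℝ j).eval (chebNode n k) = 0 := by
  have h := sumZeroes_T_of_not_dvd (n := n + 1) (k := j) (by push_cast; exact hj)
  rw [sumZeroes, mul_eq_zero] at h
  have h0 : Real.pi / ((n + 1 : ℕ) : ℝ) ≠ 0 := by positivity
  rw [← h.resolve_left h0]
  refine Finset.sum_congr rfl fun k _ => ?_
  congr 1
  rw [chebNode]
  congr 1
  push_cast
  field

-- Discrete orthogonality: `T_i T_j` is the mean of `T_{j+i}` and `T_{j-i}`, and node sums vanish
-- unless `2 (n + 1)` divides the index, which for `i, j ≤ n` happens only at index 0.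
open Polynomial.Chebyshev in
theorem chebCoeff_T {n i j : ℕ} (hi : i ≤ n) (hj : j ≤ n) :
    chebCoeff (fun x => (T ℝ (j : ℤ)).eval x) n i = if i = j then 1 else 0 := by
  have key : ∑ k ∈ Finset.range (n + 1),
      (T ℝ (j : ℤ)).eval (chebNode n k) * (T ℝ (i : ℤ)).eval (chebNode n k) =
      (∑ k ∈ Finset.range (n + 1), (T ℝ (j + i : ℤ)).eval (chebNode n k) +
        ∑ k ∈ Finset.range (n + 1), (T ℝ (j - i : ℤ)).eval (chebNode n k)) / 2 := by
    rw [← Finset.sum_add_distrib, Finset.sum_div]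
    refine Finset.sum_congr rfl fun k _ => ?_
    have := congrArg (Polynomial.eval (chebNode n k)) (T_mul_T ℝ (j : ℤ) (i : ℤ))
    simp only [Polynomial.eval_mul, Polynomial.eval_add, Polynomial.eval_ofNat] at this
    linarith
  have hN : ((n : ℝ) + 1) ≠ 0 := by positivity
  have hdvd {z : ℤ} (h0 : z ≠ 0) (h1 : |z| < 2 * ((n : ℤ) + 1)) :
      ¬ (2 * ((n : ℤ) + 1)) ∣ z := fun h =>
    h0 (Int.eq_zero_of_abs_lt_dvd h h1)
  rw [chebCoeff, key]
  by_cases hij : i = j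
  · subst hij
    have hc : ∑ k ∈ Finset.range (n + 1), (T ℝ (i - i : ℤ)).eval (chebNode n k) = n + 1 := by
      simp
    rw [hc]
    by_cases h0 : i = 0
    · subst h0
      simp
      field
    · rw [sum_T_eval_chebNode_eq_zero (hdvd (by omega) (by rw [abs_lt]; omega))]
      simp [h0, hN]
  · rw [sum_T_eval_chebNode_eq_zero (hdvd (by omega) (by rw [abs_lt]; omega)),
      sum_T_eval_chebNode_eq_zero (hdvd (by omega) (by rw [abs_lt]; omega))]
    simp [hij]

/-- The degree `n` Chebyshev approximation of `f`, evaluated at `x`. -/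
noncomputable def chebApprox (f : ℝ → ℝ) (n : ℕ) (x : ℝ) : ℝ :=
  ∑ i ∈ Finset.range (n + 1), chebCoeff f n i * (Polynomial.Chebyshev.T ℝ (i : ℤ)).eval x

open Polynomial.Chebyshev in
theorem chebApprox_T_of_le {n j : ℕ} (hj : j ≤ n) (x : ℝ) :
    chebApprox (fun x => (T ℝ (j : ℤ)).eval x) n x = (T ℝ (j : ℤ)).eval x := by
  rw [chebApprox, Finset.sum_congr rfl fun i hi => by
    rw [chebCoeff_T (Nat.lt_succ_iff.1 (Finset.mem_range.1 hi)) hj]]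
  simp [Nat.lt_succ_iff.2 hj]

theorem chebApprox_congr_mul {f g : ℝ → ℝ} {n : ℕ} {s : ℝ}
    (h : ∀ k, f (chebNode n k) = s * g (chebNode n k)) (x : ℝ) :
    chebApprox f n x = s * chebApprox g n x := by
  simp only [chebApprox, chebCoeff, h, Finset.mul_sum, Finset.sum_mul]
  refine Finset.sum_congr rfl fun i _ => Finset.sum_congr rfl fun k _ => by ring

open Polynomial.Chebyshev in
/-- Aliasing: on the nodes, every `T j` agrees up to sign with some `T i`, `i ≤ n`, or vanishes. -/
theorem exists_T_eval_chebNode_eq (n j : ℕ) :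
    ∃ s : ℝ, |s| ≤ 1 ∧ ∃ i ≤ n, ∀ k,
      (T ℝ (j : ℤ)).eval (chebNode n k) = s * (T ℝ (i : ℤ)).eval (chebNode n k) := by
  -- At a node angle `θ`, `(n + 1) θ` is an odd multiple of `π / 2`. Hence `T_{n+1}` vanishes there,
  -- while reflecting the index about `n + 1` or shifting it by `2 (n + 1)` only changes the sign.
  have hang (k : ℕ) : Real.pi * ((k : ℝ) + 1 / 2) / ((n : ℝ) + 1) * (n + 1) =
      k * Real.pi + Real.pi / 2 := by field
  have hshift (k : ℕ) (y : ℝ) : Real.cos (2 * (k * Real.pi + Real.pi / 2) + y) = -Real.cos y := by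
    rw [show 2 * (k * Real.pi + Real.pi / 2) + y = (y + Real.pi) + k * (2 * Real.pi) by ring,
      Real.cos_add_nat_mul_two_pi, Real.cos_add_pi]
  induction j using Nat.strong_induction_on with
  | _ j ih =>
  rcases le_or_gt j n with h1 | h1
  · exact ⟨1, by simp, j, h1, by simp⟩
  rcases eq_or_ne j (n + 1) with h2 | h2
  · refine ⟨0, by simp, 0, by simp, fun k => ?_⟩
    rw [chebNode, T_real_cos, zero_mul, h2]
    push_cast
    rw [mul_comm, hang, Real.cos_add_pi_div_two, Real.sin_nat_mul_pi, neg_zero]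
  rcases lt_or_ge j (2 * (n + 1)) with h3 | h3
  · refine ⟨-1, by simp, 2 * (n + 1) - j, by omega, fun k => ?_⟩
    have hc : (((2 * (n + 1) - j : ℕ) : ℤ) : ℝ) = 2 * (n + 1) - j := by
      rw [Int.cast_natCast, Nat.cast_sub h3.le]; push_cast; ring
    have ha (θ : ℝ) : (2 * ((n : ℝ) + 1) - j) * θ = 2 * (θ * (n + 1)) + -(j * θ) := by ring
    rw [chebNode, T_real_cos, T_real_cos, hc, ha, hang, hshift, Real.cos_neg, Int.cast_natCast]
    ring
  · obtain ⟨s, hs, i, hi, h⟩ := ih (j - 2 * (n + 1)) (by omega)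
    refine ⟨-s, by simpa using hs, i, hi, fun k => ?_⟩
    have hc : (((j - 2 * (n + 1) : ℕ) : ℤ) : ℝ) = j - 2 * (n + 1) := by
      rw [Int.cast_natCast, Nat.cast_sub h3]; push_cast; ring
    rw [neg_mul, ← h k, chebNode, T_real_cos, T_real_cos, hc, ← hshift k, ← hang]
    congr 1
    push_cast
    ring

open Polynomial.Chebyshev in
theorem abs_chebApprox_T_le_one (n j : ℕ) {x : ℝ} (hx : |x| ≤ 1) :
    |chebApprox (fun x => (T ℝ (j : ℤ)).eval x) n x| ≤ 1 := by
  obtain ⟨s, hs, i, hi, h⟩ := exists_T_eval_chebNode_eq n j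
  rw [chebApprox_congr_mul (g := fun x => (T ℝ (i : ℤ)).eval x) h, chebApprox_T_of_le hi, abs_mul]
  exact mul_le_one₀ hs (abs_nonneg _) (abs_eval_T_real_le_one _ hx)

theorem abs_chebNode_le_one (n k : ℕ) : |chebNode n k| ≤ 1 := Real.abs_cos_le_one _

theorem hasSum_chebApprox {f : ℝ → ℝ} {g : ℕ → ℝ → ℝ}
    (h : ∀ y, |y| ≤ 1 → HasSum (fun j => g j y) (f y)) (n : ℕ) (x : ℝ) :
    HasSum (fun j => chebApprox (g j) n x) (chebApprox f n x) := by
  refine hasSum_sum fun i _ => HasSum.mul_right _ (HasSum.mul_left _ (hasSum_sum fun k _ => ?_))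
  exact (h _ (abs_chebNode_le_one n k)).mul_right _

open Polynomial.Chebyshev in
/-- Interpolation error for a function whose Chebyshev series has geometrically decaying
coefficients. -/
theorem abs_sub_chebApprox_le {f : ℝ → ℝ} {a : ℕ → ℝ} {c r : ℝ} (hr0 : 0 ≤ r)
    (hr1 : r < 1) (n : ℕ)
    (hf : ∀ y, |y| ≤ 1 → HasSum (fun j : ℕ => a j * (T ℝ (j : ℤ)).eval y) (f y))
    (ha : ∀ j, n < j → |a j| ≤ c * r ^ j) {x : ℝ} (hx : |x| ≤ 1) :
    |f x - chebApprox f n x| ≤ 2 * c * r ^ (n + 1) / (1 - r) := by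
  have h1 := (hf x hx).sub (hasSum_chebApprox hf n x)
  have hG : HasSum (fun j => 2 * c * r ^ (n + 1) * r ^ j) (2 * c * r ^ (n + 1) / (1 - r)) := by
    simpa [div_eq_mul_inv] using (hasSum_geometric_of_lt_one hr0 hr1).mul_left (2 * c * r ^ (n + 1))
  have hmul (j : ℕ) : chebApprox (fun y => a j * (T ℝ (j : ℤ)).eval y) n x =
      a j * chebApprox (fun y => (T ℝ (j : ℤ)).eval y) n x :=
    chebApprox_congr_mul (fun _ => rfl) x
  -- Interpolation reproduces `T_j` for `j ≤ n`, so only the tail remains; each tail term costs at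
  -- most `1 + 1` times its coefficient.
  have h2 := (hasSum_nat_add_iff' (n + 1)).2 h1
  rw [Finset.sum_eq_zero, sub_zero] at h2
  · refine h2.norm_le_of_bounded hG fun j => ?_
    rw [hmul, ← mul_sub, Real.norm_eq_abs, abs_mul]
    have e1 := ha (j + (n + 1)) (by omega)
    have e2 := abs_eval_T_real_le_one ((j + (n + 1) : ℕ) : ℤ) hx
    have e3 := abs_chebApprox_T_le_one n (j + (n + 1)) hx
    have e4 := (abs_sub _ _).trans (add_le_add e2 e3)
    calc _ ≤ (c * r ^ (j + (n + 1))) * (1 + 1) :=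
          mul_le_mul e1 e4 (abs_nonneg _) ((abs_nonneg _).trans e1)
      _ = _ := by ring
  · intro j hj
    rw [hmul, chebApprox_T_of_le (Nat.lt_succ_iff.1 (Finset.mem_range.1 hj)), sub_self]

/-! ### Chebyshev series of the logarithm -/

-- Real part of the Taylor series of `-log (1 - z)` at `z = r e^{iθ}`, with `x = cos θ` and `‖1 -
-- z‖² = 1 - 2 r x + r²`.
open Polynomial.Chebyshev in
theorem hasSum_log_one_sub_two_mul_add_sq {r : ℝ} (hr0 : 0 ≤ r) (hr1 : r < 1) {x : ℝ}
    (hx : |x| ≤ 1) :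
    HasSum (fun j : ℕ => -(2 * r ^ j / j) * (T ℝ (j : ℤ)).eval x)
      (Real.log (1 - 2 * r * x + r ^ 2)) := by
  obtain ⟨θ, rfl⟩ : ∃ θ, x = Real.cos θ :=
    ⟨Real.arccos x, (Real.cos_arccos (abs_le.1 hx).1 (abs_le.1 hx).2).symm⟩
  set z : ℂ := r * Complex.exp (θ * Complex.I) with hz
  have hzn : ‖z‖ < 1 := by
    rw [hz, norm_mul, Complex.norm_exp_ofReal_mul_I, mul_one, Complex.norm_real, Real.norm_eq_abs,
      abs_of_nonneg hr0]
    exact hr1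
  have h := (Complex.hasSum_re (Complex.hasSum_taylorSeries_neg_log hzn)).mul_left (-2)
  have hpow (j : ℕ) : (z ^ j / j).re = r ^ j / j * Real.cos (j * θ) := by
    rw [hz, mul_pow, ← Complex.exp_nat_mul, ← mul_assoc,
      show ((j : ℂ) * θ) = ((j * θ : ℝ) : ℂ) by push_cast; ring, Complex.exp_mul_I,
      ← Complex.ofReal_cos, ← Complex.ofReal_sin, ← Complex.ofReal_pow,
      show ((r ^ j : ℝ) : ℂ) * ((Real.cos (j * θ) : ℝ) + (Real.sin (j * θ) : ℝ) * Complex.I) / j =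
        ((r ^ j / j * Real.cos (j * θ) : ℝ) : ℂ) +
          ((r ^ j / j * Real.sin (j * θ) : ℝ) : ℂ) * Complex.I by push_cast; ring,
      Complex.add_re, Complex.re_ofReal_mul, Complex.I_re, mul_zero, add_zero, Complex.ofReal_re]
  have hnorm : ‖1 - z‖ ^ 2 = 1 - 2 * r * Real.cos θ + r ^ 2 := by
    rw [← Complex.normSq_eq_norm_sq, Complex.normSq_apply, hz, Complex.exp_mul_I,
      ← Complex.ofReal_cos, ← Complex.ofReal_sin]
    simp only [Complex.sub_re, Complex.sub_im, Complex.one_re, Complex.one_im,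
      Complex.re_ofReal_mul, Complex.im_ofReal_mul, Complex.add_re, Complex.add_im,
      Complex.ofReal_re, Complex.ofReal_im, Complex.I_re, Complex.I_im]
    linear_combination r ^ 2 * Real.sin_sq_add_cos_sq θ
  convert! h using 1
  · funext j
    rw [hpow, T_real_cos]
    push_cast
    ring
  · rw [Complex.neg_re, Complex.log_re, ← hnorm, Real.log_pow]
    push_cast
    ring

open Polynomial.Chebyshev in
/-- Interpolation error for `log (b * (1 - 2 r x + r²))`. -/
theorem abs_log_sub_chebApprox_le {r b : ℝ} (hr0 : 0 ≤ r) (hr1 : r < 1) (hb : 0 < b) (n : ℕ)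
    {f : ℝ → ℝ} (hf : ∀ y, |y| ≤ 1 → f y = Real.log (b * (1 - 2 * r * y + r ^ 2)))
    {x : ℝ} (hx : |x| ≤ 1) :
    |f x - chebApprox f n x| ≤ 4 * r ^ (n + 1) / (1 - r) := by
  have h := abs_sub_chebApprox_le (f := f)
    (a := fun j => (if j = 0 then Real.log b else 0) + -(2 * r ^ j / j)) (c := 2) hr0 hr1 n
    (fun y hy => ?_) (fun j hj => ?_) hx
  · convert h using 2
    ring
  · have h1 := hasSum_log_one_sub_two_mul_add_sq hr0 hr1 hy
    have h2 : HasSum (fun j : ℕ => (if j = 0 then Real.log b else 0) * (T ℝ (j : ℤ)).eval y)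
        (Real.log b) := by
      convert hasSum_ite_eq (0 : ℕ) (Real.log b) using 2 with j
      split_ifs with h0
      · simp [h0]
      · simp
    have hpos : 0 < 1 - 2 * r * y + r ^ 2 := by
      have := (abs_le.1 hy).2
      nlinarith [mul_le_mul_of_nonneg_left this hr0, sq_pos_of_pos (sub_pos.2 hr1)]
    rw [hf y hy, Real.log_mul hb.ne' hpos.ne']
    convert h2.add h1 using 2 with j
    ring
  · have hj0 : j ≠ 0 := by omega
    have hj1 : (1 : ℝ) ≤ j := by exact_mod_cast Nat.one_le_iff_ne_zero.2 hj0
    rw [if_neg hj0, zero_add, abs_neg, abs_of_nonneg (by positivity)]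
    exact div_le_self (by positivity) hj1

/-! ### Spectral decomposition and the determinant -/

theorem dotProduct_chebVec_of_left_eigenvector {d : ℕ} {X : Matrix (Fin d) (Fin d) ℝ}
    {u : Fin d → ℝ} {x : ℝ} (h : ∀ w, u ⬝ᵥ (X *ᵥ w) = x * (u ⬝ᵥ w)) (v : Fin d → ℝ) (k : ℕ) :
    u ⬝ᵥ chebVec X v k = (Polynomial.Chebyshev.T ℝ (k : ℤ)).eval x * (u ⬝ᵥ v) := by
  induction k using Nat.strong_induction_on with
  | _ k ih =>
  match k with
  | 0 => simp [chebVec]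
  | 1 => simp [chebVec, h]
  | j + 2 =>
    have e := ih (j + 1) (by omega)
    push_cast at e
    rw [chebVec, dotProduct_sub, dotProduct_smul, h, e, ih j (by omega)]
    push_cast
    rw [Polynomial.Chebyshev.T_add_two]
    simp only [Polynomial.eval_sub, Polynomial.eval_mul, Polynomial.eval_ofNat, Polynomial.eval_X,
      smul_eq_mul]
    ring

/-- The right singular vectors of `C` form an orthonormal basis. -/
theorem exists_right_singular_vectors {d : ℕ} (C : Matrix (Fin d) (Fin d) ℝ) :
    ∃ u : Fin d → Fin d → ℝ, (∀ j, u j ⬝ᵥ u j = 1) ∧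
      (∀ v w, v ⬝ᵥ w = ∑ j, (u j ⬝ᵥ v) * (u j ⬝ᵥ w)) ∧
      ∀ j w, u j ⬝ᵥ ((Cᵀ * C) *ᵥ w) =
        (Matrix.toEuclideanLin C).singularValues j ^ 2 * (u j ⬝ᵥ w) := by
  set T := Matrix.toEuclideanLin C with hT
  have hn : Module.finrank ℝ (EuclideanSpace ℝ (Fin d)) = d := by simp
  set b := T.isSymmetric_adjoint_comp_self.eigenvectorBasis hn with hb
  have hin (x y : EuclideanSpace ℝ (Fin d)) :
      (WithLp.ofLp x) ⬝ᵥ (WithLp.ofLp y) = inner ℝ x y := by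
    rw [EuclideanSpace.inner_eq_star_dotProduct, star_trivial, dotProduct_comm]
  refine ⟨fun j => WithLp.ofLp (b j), fun j => ?_, fun v w => ?_, fun j w => ?_⟩
  · rw [hin, real_inner_self_eq_norm_sq, b.norm_eq_one, one_pow]
  · have h := b.sum_inner_mul_inner (WithLp.toLp 2 v) (WithLp.toLp 2 w)
    rw [← hin] at h
    rw [← WithLp.ofLp_toLp 2 v, ← WithLp.ofLp_toLp 2 w, ← h]
    refine Finset.sum_congr rfl fun j _ => ?_
    rw [hin, hin, real_inner_comm]
  · have e : (Cᵀ * C) *ᵥ w =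
        WithLp.ofLp ((T.adjoint ∘ₗ T) (WithLp.toLp 2 w)) := by
      rw [hT, ← Matrix.toEuclideanLin_conjTranspose_eq_adjoint]
      simp [Matrix.conjTranspose_eq_transpose_of_trivial]
    rw [e, hin, ← T.isSymmetric_adjoint_comp_self (b j), hb,
      LinearMap.IsSymmetric.apply_eigenvectorBasis, real_inner_smul_left, ← hin,
      ← T.sq_singularValues_fin hn j]
    rfl

theorem abs_det_eq_prod_singularValues {d : ℕ} (C : Matrix (Fin d) (Fin d) ℝ) :
    |C.det| = ∏ j : Fin d, (Matrix.toEuclideanLin C).singularValues j := by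
  have h := (Matrix.toEuclideanLin C).normDet_eq_prod_singularValues
  rw [LinearMap.normDet_eq_abs_det, LinearMap.det_toLpLin] at h
  rw [h, finrank_euclideanSpace, Fintype.card_fin, Fin.prod_univ_eq_prod_range
    (fun j => (Matrix.toEuclideanLin C).singularValues j)]

/-! ### Rademacher trace estimator and Hoeffding's inequality -/

/-- Passes from independence of all entries to independence of the sample vectors, as Hoeffding's
inequality requires. -/
theorem iIndepFun_curry {Ω β : Type*} {ι κ : Type*} [MeasurableSpace Ω] [MeasurableSpace β] {μ : Measure Ω}
    [IsProbabilityMeasure μ] [Countable ι] [Countable κ] {X : ι → κ → Ω → β}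
    (hX : ∀ i j, AEMeasurable (X i j) μ)
    (h : iIndepFun (fun p : ι × κ => X p.1 p.2) μ) :
    iIndepFun (fun i ω j => X i j ω) μ := by
  have hrow (i : ι) : AEMeasurable (fun ω j => X i j ω) μ := aemeasurable_pi_iff.2 (hX i)
  have (i : ι) (j : κ) : IsProbabilityMeasure (μ.map (X i j)) :=
    Measure.isProbabilityMeasure_map (hX i j)
  have hsig : iIndepFun (fun p : (_ : ι) × κ => X p.1 p.2) μ :=
    h.precomp (Equiv.sigmaEquivProd ι κ).injective
  have hsm : AEMeasurable (fun ω (p : (_ : ι) × κ) => X p.1 p.2 ω) μ :=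
    aemeasurable_pi_iff.2 fun p => hX p.1 p.2
  rw [iIndepFun_iff_map_fun_eq_infinitePi_map₀' hrow]
  have h1 : (fun ω i j => X i j ω) = (MeasurableEquiv.piCurry fun (_ : ι) (_ : κ) => β) ∘
      (fun ω (p : (_ : ι) × κ) => X p.1 p.2 ω) := by
    ext; simp [Sigma.curry]
  rw [h1, ← AEMeasurable.map_map_of_aemeasurable (MeasurableEquiv.measurable _).aemeasurable hsm,
    (iIndepFun_iff_map_fun_eq_infinitePi_map₀ hsm).1 hsig,
    Measure.infinitePi_map_piCurry (fun i j => μ.map (X i j))]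
  congr 1
  funext i
  have hinj : Function.Injective (fun j : κ => (i, j)) := fun _ _ h => (Prod.ext_iff.1 h).2
  have hi : iIndepFun (X i) μ := iIndepFun.precomp (g := fun j => (i, j)) hinj h
  exact ((iIndepFun_iff_map_fun_eq_infinitePi_map₀' (hX i)).1 hi).symm

theorem ae_eq_one_or_neg_one_of_rademacher {Ω : Type*} [MeasurableSpace Ω] {μ : Measure Ω}
    {X : Ω → ℝ} (h : HasLaw X rademacher μ) : ∀ᵐ ω ∂μ, X ω = 1 ∨ X ω = -1 := by
  have : ∀ᵐ x ∂(μ.map X), x = 1 ∨ x = -1 := by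
    rw [h.map_eq, rademacher, ae_add_measure_iff]
    constructor <;> refine Measure.ae_smul_measure ?_ _ <;> simp [ae_dirac_eq]
  exact ae_of_ae_map h.aemeasurable this

theorem integral_eq_zero_of_rademacher {Ω : Type*} [MeasurableSpace Ω] {μ : Measure Ω}
    {X : Ω → ℝ} (h : HasLaw X rademacher μ) : ∫ ω, X ω ∂μ = 0 := by
  have h1 : ∫ x, x ∂(μ.map X) = ∫ ω, X ω ∂μ := integral_map h.aemeasurable (by fun_prop)
  rw [← h1, h.map_eq, rademacher, integral_add_measure]
  · simp
  · exact (integrable_dirac (by simp)).smul_measure (by simp)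
  · exact (integrable_dirac (by simp)).smul_measure (by simp)

theorem integral_sq_dotProduct_of_rademacher {Ω : Type*} [MeasurableSpace Ω] {μ : Measure Ω}
    [IsProbabilityMeasure μ] {d : ℕ} {X : Fin d → Ω → ℝ} (hlaw : ∀ j, HasLaw (X j) rademacher μ)
    (hind : iIndepFun X μ) (u : Fin d → ℝ) :
    ∫ ω, (u ⬝ᵥ fun j => X j ω) ^ 2 ∂μ = u ⬝ᵥ u := by
  have hmul (k l : Fin d) : ∫ ω, X k ω * X l ω ∂μ = if k = l then 1 else 0 := by
    split_ifs with hkl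
    · subst hkl
      rw [integral_congr_ae (g := fun _ => (1 : ℝ)), integral_const]
      · simp
      · filter_upwards [ae_eq_one_or_neg_one_of_rademacher (hlaw k)] with ω h
        rcases h with h | h <;> simp [h]
    · have := (hind.indepFun hkl).integral_mul_eq_mul_integral
        (hlaw k).aemeasurable.aestronglyMeasurable (hlaw l).aemeasurable.aestronglyMeasurable
      rw [integral_eq_zero_of_rademacher (hlaw k), zero_mul] at this
      exact this
  have hint (k l : Fin d) : Integrable (fun ω => u k * u l * (X k ω * X l ω)) μ := by
    refine Integrable.const_mul (Integrable.of_mem_Icc (-1) 1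
      ((hlaw k).aemeasurable.mul (hlaw l).aemeasurable) ?_) _
    filter_upwards [ae_eq_one_or_neg_one_of_rademacher (hlaw k),
      ae_eq_one_or_neg_one_of_rademacher (hlaw l)] with ω h1 h2
    rcases h1 with h1 | h1 <;> rcases h2 with h2 | h2 <;> simp [h1, h2]
  have hexp (ω : Ω) : (u ⬝ᵥ fun j => X j ω) ^ 2 =
      ∑ k, ∑ l, u k * u l * (X k ω * X l ω) := by
    rw [sq, dotProduct, Finset.sum_mul_sum]
    exact Finset.sum_congr rfl fun k _ => Finset.sum_congr rfl fun l _ => by ring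
  simp_rw [hexp]
  rw [integral_finsetSum _ fun k _ => integrable_finsetSum _ fun l _ => hint k l]
  simp_rw [integral_finsetSum Finset.univ fun l _ => hint _ l, integral_const_mul, hmul]
  simp [dotProduct]

/-- Two-sided Hoeffding inequality for the mean of independent bounded variables. -/
theorem measure_abs_sum_sub_ge_le_of_mem_Icc {Ω : Type*} [MeasurableSpace Ω] {μ : Measure Ω}
    [IsProbabilityMeasure μ] {m : ℕ} {Q : Fin m → Ω → ℝ} (hind : iIndepFun Q μ)
    (hQ : ∀ i, AEMeasurable (Q i) μ) {a b c t : ℝ}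
    (hab : ∀ i, ∀ᵐ ω ∂μ, Q i ω ∈ Set.Icc a b) (hc : ∀ i, ∫ ω, Q i ω ∂μ = c) (ht : 0 ≤ t) :
    μ.real {ω | m * t ≤ |∑ i, (Q i ω - c)|} ≤ 2 * Real.exp (-(2 * m * t ^ 2 / (b - a) ^ 2)) := by
  have hind' : iIndepFun (fun i ω => Q i ω - c) μ :=
    hind.comp (fun _ x => x - c) fun _ => by fun_prop
  have hind'' : iIndepFun (fun i => -(fun ω => Q i ω - c)) μ :=
    hind'.comp (fun _ x => -x) fun _ => by fun_prop
  have hsub (i : Fin m) :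
      HasSubgaussianMGF (fun ω => Q i ω - c) ((‖b - a‖₊ / 2) ^ 2) μ := by
    have := hasSubgaussianMGF_of_mem_Icc (hQ i) (hab i)
    rwa [hc i] at this
  have hmt : 0 ≤ m * t := by positivity
  have h1 := HasSubgaussianMGF.measure_sum_ge_le_of_iIndepFun hind' (s := Finset.univ)
    (fun i _ => hsub i) hmt
  have h2 := HasSubgaussianMGF.measure_sum_ge_le_of_iIndepFun hind'' (s := Finset.univ)
    (fun i _ => (hsub i).neg) hmt
  -- If `m = 0` or `b = a`, both sides are 0 by the convention for division by zero.
  have hexp : -(m * t) ^ 2 / (2 * ((∑ _i : Fin m, (‖b - a‖₊ / 2) ^ 2 : NNReal) : ℝ)) =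
      -(2 * m * t ^ 2 / (b - a) ^ 2) := by
    rcases eq_or_ne m 0 with rfl | hm
    · simp
    rcases eq_or_ne (b - a) 0 with hba | hba
    · simp [hba]
    have : (m : ℝ) ≠ 0 := by exact_mod_cast hm
    simp only [Finset.sum_const, Finset.card_univ, Fintype.card_fin]
    push_cast
    rw [nsmul_eq_mul, Real.norm_eq_abs, div_pow, sq_abs]
    field
  rw [hexp] at h1 h2
  refine (measureReal_mono (s₂ := {ω | m * t ≤ ∑ i, (Q i ω - c)} ∪
    {ω | m * t ≤ ∑ i, (-(fun ω => Q i ω - c)) ω}) fun ω hω => ?_).trans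
    ((measureReal_union_le _ _).trans (by linarith))
  rcases le_abs.1 (Set.mem_ofPred_eq ▸ hω) with h | h
  · exact Or.inl h
  · refine Or.inr ?_
    simpa only [Set.mem_ofPred_eq, Pi.neg_apply, Finset.sum_neg_distrib] using h

/-- A sign vector has squared norm exactly `d`, so by Parseval the nonnegative weights `(u j ⬝ᵥ v) ^
2` sum to `d`. -/
theorem sum_mul_sq_dotProduct_mem_Icc {d : ℕ} {u : Fin d → Fin d → ℝ}
    (hu : ∀ v w, v ⬝ᵥ w = ∑ j, (u j ⬝ᵥ v) * (u j ⬝ᵥ w)) {p : Fin d → ℝ} {a b : ℝ}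
    (hp : ∀ j, p j ∈ Set.Icc a b) {v : Fin d → ℝ} (hv : ∀ j, v j = 1 ∨ v j = -1) :
    ∑ j, p j * (u j ⬝ᵥ v) ^ 2 ∈ Set.Icc (d * a) (d * b) := by
  have hvv : v ⬝ᵥ v = d := by
    have (j : Fin d) : v j * v j = 1 := by rcases hv j with h | h <;> simp [h]
    simp [dotProduct, this]
  have hw : ∑ j, (u j ⬝ᵥ v) ^ 2 = d := by
    rw [← hvv, hu v v]
    exact Finset.sum_congr rfl fun j _ => by ring
  rw [← hw, Finset.sum_mul, Finset.sum_mul]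
  constructor <;> refine Finset.sum_le_sum fun j _ => ?_
  · nlinarith [mul_le_mul_of_nonneg_right (hp j).1 (sq_nonneg (u j ⬝ᵥ v))]
  · nlinarith [mul_le_mul_of_nonneg_right (hp j).2 (sq_nonneg (u j ⬝ᵥ v))]

/-- Concentration of the Rademacher trace estimator of a symmetric matrix with orthonormal
eigenbasis `u` and eigenvalues `p j ∈ [a, b]`. -/
theorem measure_abs_rademacher_trace_estimator_sub_ge_le {Ω : Type*} [MeasurableSpace Ω]
    {μ : Measure Ω} [IsProbabilityMeasure μ] {d m : ℕ} {V : Fin m → Fin d → Ω → ℝ}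
    (hlaw : ∀ i j, HasLaw (V i j) rademacher μ)
    (hindep : iIndepFun (fun p : Fin m × Fin d => V p.1 p.2) μ)
    {u : Fin d → Fin d → ℝ} (hu1 : ∀ j, u j ⬝ᵥ u j = 1)
    (hu : ∀ v w, v ⬝ᵥ w = ∑ j, (u j ⬝ᵥ v) * (u j ⬝ᵥ w)) {p : Fin d → ℝ} {a b t : ℝ}
    (hp : ∀ j, p j ∈ Set.Icc a b) (ht : 0 ≤ t) :
    μ.real {ω | m * t ≤
      |∑ i, (∑ j, p j * (u j ⬝ᵥ fun k => V i k ω) ^ 2 - ∑ j, p j)|} ≤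
      2 * Real.exp (-(2 * m * t ^ 2 / (d * b - d * a) ^ 2)) := by
  have hm (i : Fin m) : AEMeasurable (fun ω k => V i k ω) μ :=
    aemeasurable_pi_iff.2 fun k => (hlaw i k).aemeasurable
  have hmeas : Measurable fun v : Fin d → ℝ => ∑ j, p j * (u j ⬝ᵥ v) ^ 2 := by
    simp only [dotProduct]
    fun_prop
  have hae (i : Fin m) : ∀ᵐ ω ∂μ, ∀ k, V i k ω = 1 ∨ V i k ω = -1 :=
    ae_all_iff.2 fun k => ae_eq_one_or_neg_one_of_rademacher (hlaw i k)
  have hrow (i : Fin m) : iIndepFun (V i) μ :=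
    iIndepFun.precomp (g := fun k => (i, k)) (fun _ _ h => (Prod.ext_iff.1 h).2) hindep
  refine measure_abs_sum_sub_ge_le_of_mem_Icc
    (Q := fun i ω => ∑ j, p j * (u j ⬝ᵥ fun k => V i k ω) ^ 2)
    ((iIndepFun_curry (fun i k => (hlaw i k).aemeasurable) hindep).comp _ fun _ => hmeas)
    (fun i => hmeas.comp_aemeasurable (hm i)) (fun i => ?_) (fun i => ?_) ht
  · filter_upwards [hae i] with ω h using sum_mul_sq_dotProduct_mem_Icc hu hp h
  · rw [integral_finsetSum]
    · simp_rw [integral_const_mul, integral_sq_dotProduct_of_rademacher (hlaw i) (hrow i), hu1,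
        mul_one]
    · intro j _
      refine Integrable.const_mul (Integrable.of_mem_Icc 0 d ?_ ?_) _
      · have : Measurable fun v : Fin d → ℝ => (u j ⬝ᵥ v) ^ 2 := by
          simp only [dotProduct]
          fun_prop
        exact this.comp_aemeasurable (hm i)
      · filter_upwards [hae i] with ω h
        have := sum_mul_sq_dotProduct_mem_Icc hu (p := fun l => if l = j then 1 else 0)
          (a := 0) (b := 1) (fun l => by split_ifs <;> simp) h
        simpa using this

/-! ### Consequences of the degree threshold -/

theorem log_one_add_inv_pos {K : ℝ} (hK : 1 ≤ K) : 0 < Real.log (1 + K⁻¹) :=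
  Real.log_pos (by linarith [inv_pos.2 (by linarith : 0 < K)])

theorem log_one_add_inv_le_log_one_add {K : ℝ} (hK : 1 ≤ K) :
    Real.log (1 + K⁻¹) ≤ Real.log (1 + K) :=
  Real.log_le_log (by positivity) (by linarith [inv_le_one_of_one_le₀ hK])

theorem log_one_add_inv_le_log_two_mul {K : ℝ} (hK : 1 ≤ K) :
    Real.log (1 + K⁻¹) ≤ Real.log (2 * K) :=
  Real.log_le_log (by positivity) (by linarith [inv_le_one_of_one_le₀ hK])

theorem le_sqrt_two_mul_sq_add_one (κ : ℝ) : κ ≤ √(2 * κ ^ 2 + 1) :=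
  Real.le_sqrt_of_sq_le (by nlinarith [sq_nonneg κ])

theorem seven_tenths_lt_sqrt_sub_one {κ : ℝ} (hκ : 1 ≤ κ) : 7 / 10 < √(2 * κ ^ 2 + 1) - 1 := by
  have : 17 / 10 < √(2 * κ ^ 2 + 1) := Real.lt_sqrt_of_sq_lt (by nlinarith)
  linarith

theorem le_pow_of_degreeThreshold_le {η κ : ℝ} {n : ℕ} (hη : 0 < η) (hκ : 1 ≤ κ)
    (hn : degreeThreshold η κ ≤ n) :
    20 / η * (√(2 * κ ^ 2 + 1) - 1) *
      (Real.log (1 + κ ^ 2) * Real.log (2 * κ ^ 2) / Real.log (1 + (κ ^ 2)⁻¹)) ≤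
    ((√(2 * κ ^ 2 + 1) + 1) / (√(2 * κ ^ 2 + 1) - 1)) ^ n := by
  have hK : 1 ≤ κ ^ 2 := one_le_pow₀ hκ
  have hs := seven_tenths_lt_sqrt_sub_one hκ
  have hl := log_one_add_inv_pos hK
  have hL := hl.trans_le (log_one_add_inv_le_log_one_add hK)
  have hL2 := hl.trans_le (log_one_add_inv_le_log_two_mul hK)
  have hs0 : 0 < √(2 * κ ^ 2 + 1) - 1 := by linarith
  have hρ : 1 < (√(2 * κ ^ 2 + 1) + 1) / (√(2 * κ ^ 2 + 1) - 1) := by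
    rw [one_lt_div hs0]; linarith
  rw [degreeThreshold, div_le_iff₀ (Real.log_pos hρ), ← Real.log_pow] at hn
  exact (Real.log_le_log_iff (by positivity) (pow_pos (by linarith) n)).1 hn

theorem chebyshev_log_error_le {η κ : ℝ} {n : ℕ} (hη : 0 < η) (hκ : 1 ≤ κ)
    (hn : degreeThreshold η κ ≤ n) :
    4 * ((κ - 1) / (κ + 1)) ^ (n + 1) / (1 - (κ - 1) / (κ + 1)) ≤ η / 5 := by
  have h := le_pow_of_degreeThreshold_le hη hκ hn
  have hK : 1 ≤ κ ^ 2 := one_le_pow₀ hκ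
  have hs := seven_tenths_lt_sqrt_sub_one hκ
  have hκs := le_sqrt_two_mul_sq_add_one κ
  set s := √(2 * κ ^ 2 + 1)
  have hl := log_one_add_inv_pos hK
  have hL := log_one_add_inv_le_log_one_add hK
  have hL2 : 1 / 2 ≤ Real.log (2 * κ ^ 2) :=
    (by linarith [Real.log_two_gt_d9] : 1 / 2 ≤ Real.log 2).trans
      (Real.log_le_log (by norm_num) (by linarith))
  have hq : 1 / 2 ≤ Real.log (1 + κ ^ 2) * Real.log (2 * κ ^ 2) / Real.log (1 + (κ ^ 2)⁻¹) := by
    rw [le_div_iff₀ hl]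
    nlinarith
  have hr0 : 0 ≤ (κ - 1) / (κ + 1) := div_nonneg (by linarith) (by linarith)
  -- Since `κ ≤ s`, the base `(s + 1) / (s - 1)` of the threshold is at most the true rate `r⁻¹ = (κ
  -- + 1) / (κ - 1)` (when `κ > 1`).
  have hrρ : (κ - 1) / (κ + 1) * ((s + 1) / (s - 1)) ≤ 1 := by
    rw [div_mul_div_comm, div_le_one (by nlinarith)]
    nlinarith
  have hpow : ((κ - 1) / (κ + 1)) ^ n * ((s + 1) / (s - 1)) ^ n ≤ 1 := by
    rw [← mul_pow]
    exact pow_le_one₀ (mul_nonneg hr0 (div_nonneg (by linarith) (by linarith))) hrρ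
  have h10 : 10 / η * (s - 1) ≤ ((s + 1) / (s - 1)) ^ n := by
    refine le_trans ?_ h
    have h0 : 0 ≤ 20 / η * (s - 1) := mul_nonneg (by positivity) (by linarith)
    calc 10 / η * (s - 1) = 20 / η * (s - 1) * (1 / 2) := by ring
      _ ≤ _ := mul_le_mul_of_nonneg_left hq h0
  have hrn : 0 ≤ ((κ - 1) / (κ + 1)) ^ n := pow_nonneg hr0 n
  have h3 : ((κ - 1) / (κ + 1)) ^ n * (10 / η * (s - 1)) ≤ 1 :=
    (mul_le_mul_of_nonneg_left h10 hrn).trans hpow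
  have h4 : ((κ - 1) / (κ + 1)) ^ n * (10 * (s - 1)) ≤ η := by
    have := mul_le_mul_of_nonneg_right h3 hη.le
    calc _ = ((κ - 1) / (κ + 1)) ^ n * (10 / η * (s - 1)) * η := by field
      _ ≤ _ := by linarith
  have h5 : 4 * ((κ - 1) / (κ + 1)) ^ (n + 1) / (1 - (κ - 1) / (κ + 1)) =
      2 * (κ - 1) * ((κ - 1) / (κ + 1)) ^ n := by
    have : κ + 1 ≠ 0 := by linarith
    have h1 : 1 - (κ - 1) / (κ + 1) = 2 / (κ + 1) := by field
    rw [h1, pow_succ]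
    field
  rw [h5]
  nlinarith [mul_le_mul_of_nonneg_left hκs hrn]

/-- With `n ≤ 1` the threshold gives `20 (s - 1)² log (1 + κ²) ≤ η (s + 1)`, and `s + 1 ≤ 20 (s -
1)²` because `s > 17 / 10`. -/
theorem log_one_add_sq_le_of_degreeThreshold_le {η κ : ℝ} {n : ℕ} (hη : 0 < η) (hκ : 1 ≤ κ)
    (hn : degreeThreshold η κ ≤ n) (hn1 : n ≤ 1) : Real.log (1 + κ ^ 2) ≤ η := by
  have h := le_pow_of_degreeThreshold_le hη hκ hn
  have hK : 1 ≤ κ ^ 2 := one_le_pow₀ hκ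
  have hs := seven_tenths_lt_sqrt_sub_one hκ
  set s := √(2 * κ ^ 2 + 1)
  have hs0 : 0 < s - 1 := by linarith
  have hl := log_one_add_inv_pos hK
  have hL := hl.trans_le (log_one_add_inv_le_log_one_add hK)
  have hL2 := log_one_add_inv_le_log_two_mul hK
  have hρ : 1 ≤ (s + 1) / (s - 1) := by
    rw [one_le_div hs0]; linarith
  have h1 := h.trans (pow_le_pow_right₀ hρ hn1)
  rw [pow_one] at h1
  have hq : Real.log (1 + κ ^ 2) ≤
      Real.log (1 + κ ^ 2) * Real.log (2 * κ ^ 2) / Real.log (1 + (κ ^ 2)⁻¹) := by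
    rw [le_div_iff₀ hl]
    exact mul_le_mul_of_nonneg_left hL2 hL.le
  have h2 := (mul_le_mul_of_nonneg_left hq (by positivity : 0 ≤ 20 / η * (s - 1))).trans h1
  rw [le_div_iff₀ hs0] at h2
  have h3 : 20 * (s - 1) ^ 2 * Real.log (1 + κ ^ 2) ≤ η * (s + 1) := by
    have := mul_le_mul_of_nonneg_left h2 hη.le
    calc _ = η * (20 / η * (s - 1) * Real.log (1 + κ ^ 2) * (s - 1)) := by field
      _ ≤ _ := this
  have h4 : s + 1 ≤ 20 * (s - 1) ^ 2 := by nlinarith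
  have h5 := (mul_le_mul_of_nonneg_right h4 hL.le).trans h3
  exact le_of_mul_le_mul_left (by linarith) (by linarith : 0 < s + 1)

/-! ### The algorithm's polynomial and its range -/

/-- The polynomial applied to the matrix by the algorithm: the Chebyshev approximation of degree
`n`, truncated to its constant term when `n ≤ 1`. -/
noncomputable def algPoly (f : ℝ → ℝ) (n : ℕ) (x : ℝ) : ℝ :=
  if 1 < n then chebApprox f n x else chebCoeff f n 0

theorem logDetPD_eq_sum {d m n : ℕ} {B : Matrix (Fin d) (Fin d) ℝ} {δ : ℝ}
    {u : Fin d → Fin d → ℝ} {b : Fin d → ℝ}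
    (hu : ∀ v w, v ⬝ᵥ w = ∑ j, (u j ⬝ᵥ v) * (u j ⬝ᵥ w))
    (hB : ∀ j w, u j ⬝ᵥ (B *ᵥ w) = b j * (u j ⬝ᵥ w)) (v : Fin m → Fin d → ℝ) :
    logDetPD B m n δ v = (∑ i, ∑ j,
      algPoly (fun x => Real.log (1 - ((1 - 2 * δ) * x + 1) / 2)) n
        ((1 - 2 * δ)⁻¹ * (2 * (1 - b j) - 1)) * (u j ⬝ᵥ v i) ^ 2) / m := by
  have hX (j : Fin d) (w : Fin d → ℝ) :
      u j ⬝ᵥ (((1 - 2 * δ)⁻¹ • ((2 : ℝ) • (1 - B) - 1)) *ᵥ w) =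
        ((1 - 2 * δ)⁻¹ * (2 * (1 - b j) - 1)) * (u j ⬝ᵥ w) := by
    simp only [Matrix.smul_mulVec, Matrix.sub_mulVec, Matrix.one_mulVec, dotProduct_smul,
      dotProduct_sub, hB, smul_eq_mul]
    ring
  simp only [logDetPD]
  rw [← Finset.sum_div]
  congr 1
  refine Finset.sum_congr rfl fun i _ => ?_
  simp only [algPoly]
  split_ifs with hn
  · rw [hu]
    refine Finset.sum_congr rfl fun j _ => ?_
    rw [dotProduct_sum, chebApprox, Finset.mul_sum, Finset.sum_mul]
    refine Finset.sum_congr rfl fun k _ => ?_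
    rw [dotProduct_smul, dotProduct_chebVec_of_left_eigenvector (hX j), smul_eq_mul]
    ring
  · rw [dotProduct_smul, hu, ← Finset.mul_sum, smul_eq_mul]
    congr 1
    exact Finset.sum_congr rfl fun j _ => by ring

/-- With `δ = 1 / (1 + K)`, the argument of the logarithm stays in `[δ, 1 - δ] = [1 / (1 + K), 1 /
(1 + K⁻¹)]`. -/
theorem logDet_integrand_mem_Icc {K x : ℝ} (hK : 1 ≤ K) (hx : |x| ≤ 1) :
    Real.log (1 - ((1 - 2 * (1 + K)⁻¹) * x + 1) / 2) ∈
      Set.Icc (-Real.log (1 + K)) (-Real.log (1 + K⁻¹)) := by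
  have hx' := abs_le.1 hx
  have hK1 : 0 < 1 + K := by linarith
  have he : 1 - ((1 - 2 * (1 + K)⁻¹) * x + 1) / 2 = ((1 + K) - (K - 1) * x) / (2 * (1 + K)) := by
    field
  rw [he, ← Real.log_inv, ← Real.log_inv]
  constructor
  · refine Real.log_le_log (by positivity) ?_
    rw [le_div_iff₀ (by positivity)]
    have : (1 + K)⁻¹ * (2 * (1 + K)) = 2 := by field
    rw [this]
    nlinarith
  · have : (1 + K⁻¹)⁻¹ = K / (1 + K) := by field
    rw [this]
    refine Real.log_le_log (div_pos (by nlinarith) (by positivity)) ?_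
    rw [div_le_div_iff₀ (by positivity) hK1]
    nlinarith [mul_pos hK1 hK1, mul_nonneg (mul_nonneg (by linarith : 0 ≤ K - 1)
      (by linarith [hx'.1] : 0 ≤ 1 + x)) hK1.le]

/-- The constant coefficient is the average of `f` over the nodes. -/
theorem chebCoeff_zero_mem_Icc {f : ℝ → ℝ} {a b : ℝ} (h : ∀ x, |x| ≤ 1 → f x ∈ Set.Icc a b)
    (n : ℕ) : chebCoeff f n 0 ∈ Set.Icc a b := by
  have hN : (0 : ℝ) < n + 1 := by positivity
  have e : chebCoeff f n 0 = (∑ k ∈ Finset.range (n + 1), f (chebNode n k)) / (n + 1) := by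
    simp [chebCoeff]
    ring
  rw [e, Set.mem_Icc, le_div_iff₀ hN, div_le_iff₀ hN]
  have hc (c : ℝ) : c * (n + 1) = ∑ _k ∈ Finset.range (n + 1), c := by
    simp
    ring
  rw [hc, hc]
  exact ⟨Finset.sum_le_sum fun k _ => (h _ (abs_chebNode_le_one n k)).1,
    Finset.sum_le_sum fun k _ => (h _ (abs_chebNode_le_one n k)).2⟩

theorem abs_logDet_integrand_sub_chebApprox_le {η κ x : ℝ} {n : ℕ} (hη : 0 < η) (hκ : 1 ≤ κ)
    (hn : degreeThreshold η κ ≤ n) (hx : |x| ≤ 1) :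
    |Real.log (1 - ((1 - 2 * (1 + κ ^ 2)⁻¹) * x + 1) / 2) -
      chebApprox (fun x => Real.log (1 - ((1 - 2 * (1 + κ ^ 2)⁻¹) * x + 1) / 2)) n x| ≤ η / 5 := by
  have hκ1 : 0 < κ + 1 := by linarith
  have hr0 : 0 ≤ (κ - 1) / (κ + 1) := div_nonneg (by linarith) hκ1.le
  have hr1 : (κ - 1) / (κ + 1) < 1 := by rw [div_lt_one hκ1]; linarith
  refine le_trans (abs_log_sub_chebApprox_le
    (f := fun x => Real.log (1 - ((1 - 2 * (1 + κ ^ 2)⁻¹) * x + 1) / 2))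
    (b := (2 * (1 + ((κ - 1) / (κ + 1)) ^ 2))⁻¹) hr0 hr1 (by positivity) n (fun y _ => ?_) hx) (chebyshev_log_error_le hη hκ hn)
  congr 1
  -- The choice of `r` solves `2 r / (1 + r²) = (κ² - 1) / (κ² + 1) = 1 - 2 δ`.
  have h1 : (1 + κ ^ 2 : ℝ) ≠ 0 := by positivity
  have h2 : 1 + ((κ - 1) / (κ + 1)) ^ 2 = 2 * (1 + κ ^ 2) / (κ + 1) ^ 2 := by field
  rw [h2]
  field

theorem algPoly_mem_Icc {η κ x : ℝ} {n : ℕ} (hη : 0 < η) (hκ : 1 ≤ κ)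
    (hn : degreeThreshold η κ ≤ n) (hx : |x| ≤ 1) :
    algPoly (fun x => Real.log (1 - ((1 - 2 * (1 + κ ^ 2)⁻¹) * x + 1) / 2)) n x ∈
      Set.Icc (-Real.log (1 + κ ^ 2) - η / 5) (-Real.log (1 + (κ ^ 2)⁻¹) + η / 5) := by
  have hK : 1 ≤ κ ^ 2 := one_le_pow₀ hκ
  rw [algPoly]
  split_ifs with h
  · have h1 := abs_le.1 (abs_logDet_integrand_sub_chebApprox_le hη hκ hn hx)
    have h2 := logDet_integrand_mem_Icc hK hx
    constructor <;> linarith [h1.1, h1.2, h2.1, h2.2]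
  · have h2 := chebCoeff_zero_mem_Icc (fun x hx => logDet_integrand_mem_Icc (x := x) hK hx) n
    constructor <;> linarith [h2.1, h2.2]

/-! ### Probability bound and conclusion -/

theorem one_sub_le_measureReal_of_compl_subset {Ω : Type*} [MeasurableSpace Ω] {μ : Measure Ω}
    [IsProbabilityMeasure μ] {s t : Set Ω} {ζ : ℝ} (h : sᶜ ⊆ t) (ht : μ.real t ≤ ζ) :
    1 - ζ ≤ μ.real s := by
  have h1 : 1 ≤ μ.real s + μ.real sᶜ := by
    have := measureReal_union_le (μ := μ) s sᶜ
    rwa [Set.union_compl_self, probReal_univ] at this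
  linarith [measureReal_mono (μ := μ) h]

theorem hoeffding_bound_le {η L M ζ w x : ℝ} {d m : ℕ} (hd : 0 < d) (hη : 0 < η)
    (hζ : ζ ∈ Set.Ioo (0 : ℝ) 1) (hm : 14 / η ^ 2 * L ^ 2 * Real.log (2 / ζ) ≤ m)
    (hx : x = d * w) (hw0 : 0 < w) (hw : w ≤ 7 / 5 * L) (hM : M = d * (9 / 5 * η)) :
    2 * Real.exp (-(2 * m * M ^ 2 / x ^ 2)) ≤ ζ := by
  have hd' : (0 : ℝ) < d := by exact_mod_cast hd
  have hlog : 0 ≤ Real.log (2 / ζ) :=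
    Real.log_nonneg (by rw [le_div_iff₀ hζ.1]; linarith [hζ.2])
  have h1 : 2 * m * M ^ 2 / x ^ 2 = 162 / 25 * η ^ 2 * m / w ^ 2 := by
    rw [hM, hx]
    field
  have h2 : 14 * L ^ 2 * Real.log (2 / ζ) ≤ η ^ 2 * m := by
    have := mul_le_mul_of_nonneg_left hm (sq_nonneg η)
    calc _ = η ^ 2 * (14 / η ^ 2 * L ^ 2 * Real.log (2 / ζ)) := by field
      _ ≤ _ := this
  -- `(7 / 5)² < 2`; the constant 14 leaves ample room in the next bound.
  have h3 : w ^ 2 ≤ 2 * L ^ 2 := by nlinarith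
  have h4 : Real.log (2 / ζ) ≤ 2 * m * M ^ 2 / x ^ 2 := by
    rw [h1, le_div_iff₀ (by positivity)]
    nlinarith [mul_le_mul_of_nonneg_left h3 hlog, mul_nonneg hlog (sq_nonneg L)]
  calc 2 * Real.exp (-(2 * m * M ^ 2 / x ^ 2)) ≤ 2 * Real.exp (-Real.log (2 / ζ)) := by gcongr
    _ = ζ := by
      rw [Real.exp_neg, Real.exp_log (div_pos two_pos hζ.1)]
      field

/-- Concentration of the estimator around `∑ j, f (x j)`, given the spectral decomposition. -/
theorem measure_abs_estimator_sub_le {Ω : Type*} [MeasurableSpace Ω] {μ : Measure Ω}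
    [IsProbabilityMeasure μ] {d m n : ℕ} (hd : 0 < d) {V : Fin m → Fin d → Ω → ℝ}
    (hlaw : ∀ i j, HasLaw (V i j) rademacher μ)
    (hindep : iIndepFun (fun p : Fin m × Fin d => V p.1 p.2) μ)
    {u : Fin d → Fin d → ℝ} (hu1 : ∀ j, u j ⬝ᵥ u j = 1)
    (hu : ∀ v w, v ⬝ᵥ w = ∑ j, (u j ⬝ᵥ v) * (u j ⬝ᵥ w))
    {η κ ζ : ℝ} (hη : 0 < η) (hκ : 1 ≤ κ) (hζ : ζ ∈ Set.Ioo (0 : ℝ) 1)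
    (hm : sampleThreshold η κ ζ ≤ m) (hn : degreeThreshold η κ ≤ n)
    {f : ℝ → ℝ} (hf : f = fun x => Real.log (1 - ((1 - 2 * (1 + κ ^ 2)⁻¹) * x + 1) / 2))
    {x : Fin d → ℝ} (hx : ∀ j, |x j| ≤ 1) :
    1 - ζ ≤ μ.real {ω | |(∑ i, ∑ j, algPoly f n (x j) * (u j ⬝ᵥ fun k => V i k ω) ^ 2) / m -
      ∑ j, f (x j)| ≤ 2 * η * d} := by
  subst hf
  set f : ℝ → ℝ := fun x => Real.log (1 - ((1 - 2 * (1 + κ ^ 2)⁻¹) * x + 1) / 2)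
  have hd' : (0 : ℝ) < d := by exact_mod_cast hd
  have hK : 1 ≤ κ ^ 2 := one_le_pow₀ hκ
  have hl := log_one_add_inv_pos hK
  have hlL := log_one_add_inv_le_log_one_add hK
  set L := Real.log (1 + κ ^ 2)
  set l := Real.log (1 + (κ ^ 2)⁻¹)
  have hL : 0 < L := hl.trans_le hlL
  have hp (j : Fin d) : algPoly f n (x j) ∈ Set.Icc (-L - η / 5) (-l + η / 5) :=
    algPoly_mem_Icc hη hκ hn (hx j)
  have hm0 : (0 : ℝ) < m := by
    have : 0 < Real.log (2 / ζ) :=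
      Real.log_pos (by rw [lt_div_iff₀ hζ.1]; linarith [hζ.2])
    exact lt_of_lt_of_le (by rw [sampleThreshold]; positivity) hm
  -- If `L ≤ η`, the estimate holds almost surely: estimator and target differ by at most `d (L - l
  -- + η / 5) ≤ 2 η d`, whatever `n` is.
  rcases le_or_gt L η with hLη | hLη
  · have hF : ∑ j, f (x j) ∈ Set.Icc (d * -L) (d * -l) := by
      have hc (c : ℝ) : d * c = ∑ _j : Fin d, c := by simp
      rw [hc, hc]
      exact ⟨Finset.sum_le_sum fun j _ => (logDet_integrand_mem_Icc hK (hx j)).1,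
        Finset.sum_le_sum fun j _ => (logDet_integrand_mem_Icc hK (hx j)).2⟩
    have hae : ∀ᵐ ω ∂μ, ∀ i k, V i k ω = 1 ∨ V i k ω = -1 :=
      ae_all_iff.2 fun i => ae_all_iff.2 fun k => ae_eq_one_or_neg_one_of_rademacher (hlaw i k)
    refine one_sub_le_measureReal_of_compl_subset (t := {ω | ¬ ∀ i k, V i k ω = 1 ∨ V i k ω = -1})
      (Set.compl_subset_comm.1 fun ω hω => ?_) ?_
    · have hω' : ∀ i k, V i k ω = 1 ∨ V i k ω = -1 := not_not.1 hω
      have hQ (i : Fin m) := sum_mul_sq_dotProduct_mem_Icc hu hp (hω' i)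
      have hS : (∑ i, ∑ j, algPoly f n (x j) * (u j ⬝ᵥ fun k => V i k ω) ^ 2) / m ∈
          Set.Icc (d * (-L - η / 5)) (d * (-l + η / 5)) := by
        rw [Set.mem_Icc, le_div_iff₀ hm0, div_le_iff₀ hm0]
        have hc (c : ℝ) : c * m = ∑ _i : Fin m, c := by simp [mul_comm]
        rw [hc, hc]
        exact ⟨Finset.sum_le_sum fun i _ => (hQ i).1, Finset.sum_le_sum fun i _ => (hQ i).2⟩
      have h1 : (d : ℝ) * (L - l + η / 5) ≤ d * (2 * η) :=
        mul_le_mul_of_nonneg_left (by linarith) hd'.le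
      rw [Set.mem_ofPred_eq, abs_le]
      constructor <;> linarith [hS.1, hS.2, hF.1, hF.2]
    · have h0 : μ {ω | ¬ ∀ i k, V i k ω = 1 ∨ V i k ω = -1} = 0 := ae_iff.1 hae
      rw [measureReal_def, h0]
      simpa using hζ.1.le
  · have hn1 : 1 < n := by
      by_contra h
      exact hLη.not_ge (log_one_add_sq_le_of_degreeThreshold_le hη hκ hn (not_lt.1 h))
    have hE : |∑ j, algPoly f n (x j) - ∑ j, f (x j)| ≤ d * (η / 5) := by
      rw [← Finset.sum_sub_distrib]
      refine (Finset.abs_sum_le_sum_abs _ _).trans ((Finset.sum_le_sum (g := fun _ => η / 5)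
        fun j _ => ?_).trans_eq (by simp))
      rw [algPoly, if_pos hn1, abs_sub_comm]
      exact abs_logDet_integrand_sub_chebApprox_le hη hκ hn (hx j)
    -- The tolerance splits as `2 = 9 / 5 + 1 / 5`. The spread `w = L - l + 2 η / 5` is at most `7 L
    -- / 5` because `η < L` and `l > 0`.
    refine one_sub_le_measureReal_of_compl_subset (fun ω hω => ?_)
      ((measure_abs_rademacher_trace_estimator_sub_ge_le hlaw hindep hu1 hu hp
        (t := d * (9 / 5 * η)) (by positivity)).trans
        (hoeffding_bound_le (w := L - l + 2 * (η / 5)) hd hη hζ hm (by ring) (by linarith)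
          (by linarith) rfl))
    by_contra hlt
    have hlt' := (not_le.1 (Set.mem_ofPred_eq ▸ hlt)).le
    refine hω ?_
    have e : ∑ i : Fin m, (∑ j, algPoly f n (x j) * (u j ⬝ᵥ fun k => V i k ω) ^ 2 -
        ∑ j, algPoly f n (x j)) =
        m * ((∑ i, ∑ j, algPoly f n (x j) * (u j ⬝ᵥ fun k => V i k ω) ^ 2) / m -
          ∑ j, algPoly f n (x j)) := by
      rw [Finset.sum_sub_distrib, mul_sub, mul_div_cancel₀ _ hm0.ne']
      simp
    rw [e, abs_mul, abs_of_pos hm0] at hlt'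
    have h1 := le_of_mul_le_mul_left hlt' hm0
    have h2 := (abs_sub_le _ _ _).trans (add_le_add h1 hE)
    exact h2.trans_eq (by ring)

theorem corollary2
    {Ω : Type*} [MeasurableSpace Ω] (μ : Measure Ω) [IsProbabilityMeasure μ]
    (ε ζ : ℝ) (hε : ε ∈ Set.Ioo (0 : ℝ) 1) (hζ : ζ ∈ Set.Ioo (0 : ℝ) 1)
    (d : ℕ) (C : Matrix (Fin d) (Fin d) ℝ) (σmin σmax : ℝ) (hσ : 1 < σmin)
    (hC : ∀ i < d, (Matrix.toEuclideanLin C).singularValues i ∈ Set.Icc σmin σmax)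
    (m n : ℕ)
    (hm : sampleThreshold (ε * Real.log σmin) (σmax / σmin) ζ ≤ (m : ℝ))
    (hn : degreeThreshold (ε * Real.log σmin) (σmax / σmin) ≤ (n : ℝ))
    (V : Fin m → Fin d → Ω → ℝ)
    (hlaw : ∀ i j, HasLaw (V i j) rademacher μ)
    (hindep : iIndepFun (fun p : Fin m × Fin d => V p.1 p.2) μ) :
    1 - ζ ≤ μ.real {ω |
      |Real.log |C.det| - logDetGeneral C σmin σmax m n (fun i j => V i j ω)|
        ≤ ε * Real.log |C.det|} := by
  rcases Nat.eq_zero_or_pos d with rfl | hd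
  · simp [logDetGeneral, logDetPD, hζ.1.le]
  have hσ0 : 0 < σmin := by linarith
  have hσσ : σmin ≤ σmax := (hC 0 hd).1.trans (hC 0 hd).2
  have hη : 0 < ε * Real.log σmin := mul_pos hε.1 (Real.log_pos hσ)
  have hκ : 1 ≤ σmax / σmin := (one_le_div hσ0).2 hσσ
  obtain ⟨u, hu1, hu, hCu⟩ := exists_right_singular_vectors C
  set σ : Fin d → ℝ := fun j => (Matrix.toEuclideanLin C).singularValues j with hσdef
  have hσj (j : Fin d) : σ j ∈ Set.Icc σmin σmax := hC j j.2
  set S := σmin ^ 2 + σmax ^ 2 with hS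
  have hS0 : 0 < S := by positivity
  have hδ : σmin ^ 2 / S = (1 + (σmax / σmin) ^ 2)⁻¹ := by
    rw [hS]
    field
  have hB (j : Fin d) (w : Fin d → ℝ) :
      u j ⬝ᵥ (((1 / S) • (Cᵀ * C)) *ᵥ w) = (σ j ^ 2 / S) * (u j ⬝ᵥ w) := by
    rw [Matrix.smul_mulVec, dotProduct_smul, hCu, smul_eq_mul]
    ring
  set δ := σmin ^ 2 / S with hδdef
  set x : Fin d → ℝ := fun j => (1 - 2 * δ)⁻¹ * (2 * (1 - σ j ^ 2 / S) - 1) with hxdef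
  have hb (j : Fin d) : δ ≤ σ j ^ 2 / S ∧ σ j ^ 2 / S ≤ 1 - δ := by
    have h1 : 1 - δ = σmax ^ 2 / S := by rw [hδdef, hS]; field
    rw [h1, hδdef]
    have := hσj j
    constructor <;> gcongr
    · exact this.1
    · exact (hσ0.le.trans this.1)
    · exact this.2
  have hx (j : Fin d) : (1 - 2 * δ) * x j = 2 * (1 - σ j ^ 2 / S) - 1 ∧ |x j| ≤ 1 := by
    obtain ⟨h1, h2⟩ := hb j
    -- If `δ = 1 / 2`, the inverse is 0 and so is `x j`; the identity survives because `hb` forces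
    -- `σ j ^ 2 / S = 1 / 2`.
    rcases (by linarith : 0 ≤ 1 - 2 * δ).eq_or_lt with h0 | h0
    · simp only [hxdef, ← h0]
      constructor
      · linarith
      · simp
    · constructor
      · rw [hxdef, mul_inv_cancel_left₀ h0.ne']
      · rw [hxdef, abs_mul, abs_of_pos (inv_pos.2 h0), inv_mul_le_one₀ h0, abs_le]
        constructor <;> linarith
  have hfx (j : Fin d) : Real.log (1 - ((1 - 2 * δ) * x j + 1) / 2) =
      2 * Real.log (σ j) - Real.log S := by
    have hσp : 0 < σ j := hσ0.trans_le (hσj j).1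
    rw [(hx j).1, show 1 - (2 * (1 - σ j ^ 2 / S) - 1 + 1) / 2 = σ j ^ 2 / S by ring,
      Real.log_div (by positivity) hS0.ne', Real.log_pow]
    push_cast
    ring
  have hdet : Real.log |C.det| = ∑ j, Real.log (σ j) := by
    rw [abs_det_eq_prod_singularValues, Real.log_prod fun j _ => (hσ0.trans_le (hσj j).1).ne']
  have hdet' : d * Real.log σmin ≤ Real.log |C.det| := by
    rw [hdet]
    calc d * Real.log σmin = ∑ _j : Fin d, Real.log σmin := by simp
      _ ≤ _ := Finset.sum_le_sum fun j _ => Real.log_le_log hσ0 (hσj j).1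
  have hsum : ∑ j, Real.log (1 - ((1 - 2 * δ) * x j + 1) / 2) =
      2 * Real.log |C.det| - d * Real.log S := by
    simp_rw [hfx, Finset.sum_sub_distrib, ← Finset.mul_sum, ← hdet]
    simp
  refine (measure_abs_estimator_sub_le hd hlaw hindep hu1 hu hη hκ hζ hm hn (by rw [← hδ])
    fun j => (hx j).2).trans (measureReal_mono fun ω hω => ?_)
  have hG : logDetGeneral C σmin σmax m n (fun i j => V i j ω) =
      (logDetPD ((1 / S) • (Cᵀ * C)) m n δ (fun i j => V i j ω) + d * Real.log S) / 2 := rfl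
  have hω' := Set.mem_ofPred_eq ▸ hω
  rw [hsum] at hω'
  rw [Set.mem_ofPred_eq, hG, logDetPD_eq_sum hu hB]
  have h1 := abs_le.1 hω'
  have h2 := mul_le_mul_of_nonneg_left hdet' hε.1.le
  exact abs_le.2 ⟨by linarith [h1.2], by linarith [h1.1]⟩
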